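/- Let $k$ be an algebraically closed field of characteristic different from $2$, let $V$ be a finite-dimensional vector space over $k$, and let $G=\mathrm{GL}(V)$. Let $\mathcal C$ be the vector space of commutative multiplications on $V$, i.e. of bilinear maps $m\colon V\times V\to V$ with $m(a,b)=m(b,a)$ for all $a,b\in V$, on which $G$ acts linearly by $(g\cdot m)(a,b)=g\bigl(m(g^{-1}a,g^{-1}b)\bigr)$. Consider the induced action of $G$ on the projective space $P\mathcal C$ of lines through the origin in $\mathcal C$, endowed with the Zariski topology. Then the stabilizers of points in general position in $P\mathcal C$ coincide with the center of $G$: there is a Zariski-open dense subset $U\subseteq P\mathcal C$ such that for every $x\in U$ the stabilizer $G_x=\{g\in G\mid g\cdot x=x\}$ is equal to the center of $G$, i.e. to the group of invertible scalar operators on $V$. -/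

import Mathlib

open scoped LinearAlgebra.Projectivization

section CommutativeMultiplications

variable (k V : Type*) [Field k] [AddCommGroup V] [Module k V]

/-- The vector space of commutative multiplications on `V`: the bilinear maps
`m : V × V → V` with `m a b = m b a` for all `a`, `b`. -/
def CommMul : Submodule k (V →ₗ[k] V →ₗ[k] V) where
  carrier := {m | ∀ a b, m a b = m b a}
  add_mem' := by
    intro x y hx hy a b
    simp only [LinearMap.add_apply]
    rw [hx a b, hy a b]
  zero_mem' := by
    intro a b
    rfl
  smul_mem' := by
    intro c x hx a b
    simp only [LinearMap.smul_apply]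
    rw [hx a b]

variable {k V}

/-- The transform of a commutative multiplication `m` by `g ∈ GL(V)`: the multiplication
`(a, b) ↦ g (m (g⁻¹ a) (g⁻¹ b))`. -/
def CommMul.act (g : LinearMap.GeneralLinearGroup k V) (m : CommMul k V) : CommMul k V :=
  ⟨LinearMap.mk₂ k
    (fun a b => (g : V →ₗ[k] V)
      ((m : V →ₗ[k] V →ₗ[k] V) ((↑g⁻¹ : V →ₗ[k] V) a) ((↑g⁻¹ : V →ₗ[k] V) b)))
    (by intro a a' b; simp only [map_add, LinearMap.add_apply])
    (by intro c a b; simp only [map_smul, LinearMap.smul_apply])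
    (by intro a b b'; simp only [map_add])
    (by intro c a b; simp only [map_smul]),
   by
    intro a b
    simp only [LinearMap.mk₂_apply]
    rw [m.2]⟩

theorem CommMul.act_apply (g : LinearMap.GeneralLinearGroup k V) (m : CommMul k V) (a b : V) :
    (CommMul.act g m : V →ₗ[k] V →ₗ[k] V) a b = (g : V →ₗ[k] V)
      ((m : V →ₗ[k] V →ₗ[k] V) ((↑g⁻¹ : V →ₗ[k] V) a) ((↑g⁻¹ : V →ₗ[k] V) b)) :=
  rfl

theorem CommMul.ext_apply {m m' : CommMul k V}
    (h : ∀ a b, (m : V →ₗ[k] V →ₗ[k] V) a b = (m' : V →ₗ[k] V →ₗ[k] V) a b) : m = m' :=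
  Subtype.ext (LinearMap.ext fun a => LinearMap.ext fun b => h a b)

/-- The natural linear action of `GL(V)` on the space of commutative multiplications. -/
instance CommMul.instDistribMulAction :
    DistribMulAction (LinearMap.GeneralLinearGroup k V) (CommMul k V) where
  smul := CommMul.act
  one_smul m := by
    apply CommMul.ext_apply
    intro a b
    change (CommMul.act 1 m : V →ₗ[k] V →ₗ[k] V) a b = _
    simp [CommMul.act_apply]
  mul_smul g h m := by
    apply CommMul.ext_apply
    intro a b
    change (CommMul.act (g * h) m : V →ₗ[k] V →ₗ[k] V) a b =
      (CommMul.act g (CommMul.act h m) : V →ₗ[k] V →ₗ[k] V) a b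
    simp only [CommMul.act_apply, mul_inv_rev, Units.val_mul, Module.End.mul_apply]
  smul_zero g := by
    apply CommMul.ext_apply
    intro a b
    change (CommMul.act g 0 : V →ₗ[k] V →ₗ[k] V) a b = _
    simp [CommMul.act_apply]
  smul_add g m m' := by
    apply CommMul.ext_apply
    intro a b
    change (CommMul.act g (m + m') : V →ₗ[k] V →ₗ[k] V) a b =
      ((CommMul.act g m + CommMul.act g m' : CommMul k V) : V →ₗ[k] V →ₗ[k] V) a b
    simp [CommMul.act_apply]

instance CommMul.instSMulCommClass :
    SMulCommClass (LinearMap.GeneralLinearGroup k V) k (CommMul k V) where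
  smul_comm g c m := by
    apply CommMul.ext_apply
    intro a b
    change (CommMul.act g (c • m) : V →ₗ[k] V →ₗ[k] V) a b =
      ((c • CommMul.act g m : CommMul k V) : V →ₗ[k] V →ₗ[k] V) a b
    simp [CommMul.act_apply]

theorem CommMul.smul_apply (g : LinearMap.GeneralLinearGroup k V) (m : CommMul k V) (a b : V) :
    ((g • m : CommMul k V) : V →ₗ[k] V →ₗ[k] V) a b = (g : V →ₗ[k] V)
      ((m : V →ₗ[k] V →ₗ[k] V) ((↑g⁻¹ : V →ₗ[k] V) a) ((↑g⁻¹ : V →ₗ[k] V) b)) :=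
  rfl

end CommutativeMultiplications

section ZariskiTopology

variable {k W : Type*} [Field k] [AddCommGroup W] [Module k W]

/-- The value at `w` of a polynomial in linear forms on `W`. The functions
`fun w => polyEval p w` are exactly the polynomial functions on `W`. -/
noncomputable def polyEval (p : MvPolynomial (Module.Dual k W) k) (w : W) : k :=
  MvPolynomial.eval (fun l : Module.Dual k W => l w) p

/-- The common zero locus in the projective space `ℙ k W` of a set `S` of polynomials in linear
forms: the points all of whose representatives are zeros of all members of `S`. -/
def projZeroLocus (S : Set (MvPolynomial (Module.Dual k W) k)) : Set (ℙ k W) :=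
  {x | ∀ (w : W) (hw : w ≠ 0), Projectivization.mk k w hw = x → ∀ p ∈ S, polyEval p w = 0}

theorem polyEval_smul {p : MvPolynomial (Module.Dual k W) k} {d : ℕ} (hp : p.IsHomogeneous d)
    (c : k) (w : W) : polyEval p (c • w) = c ^ d * polyEval p w := by
  unfold polyEval
  rw [MvPolynomial.eval_eq, MvPolynomial.eval_eq, Finset.mul_sum]
  refine Finset.sum_congr rfl fun m hm => ?_
  have hd := hp (MvPolynomial.mem_support_iff.mp hm)
  have : c ^ d = ∏ i ∈ m.support, c ^ m i := by
    rw [Finset.prod_pow_eq_pow_sum, ← hd, Finsupp.weight_apply, Finsupp.sum]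
    simp
  rw [this]
  simp only [map_smul, smul_eq_mul, mul_pow, Finset.prod_mul_distrib]
  ring

/-- The Zariski topology on a projective space: the closed sets are the common zero loci of sets
of homogeneous polynomials. -/
instance Projectivization.zariskiTopology : TopologicalSpace (ℙ k W) :=
  TopologicalSpace.ofClosed
    {Z | ∃ S : Set (MvPolynomial (Module.Dual k W) k),
      (∀ p ∈ S, ∃ d : ℕ, p.IsHomogeneous d) ∧ Z = projZeroLocus S}
    (by
      refine ⟨{1}, ?_, ?_⟩
      · rintro p rfl
        exact ⟨0, MvPolynomial.isHomogeneous_one _ _⟩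
      · symm
        rw [Set.eq_empty_iff_forall_notMem]
        intro x hx
        have := hx x.rep x.rep_nonzero x.mk_rep 1 rfl
        simp [polyEval] at this)
    (by
      intro A hA
      refine ⟨{p | (∃ d : ℕ, p.IsHomogeneous d) ∧ ∃ Z ∈ A, ∀ x ∈ Z, ∀ (w : W) (hw : w ≠ 0),
        Projectivization.mk k w hw = x → polyEval p w = 0}, fun p hp => hp.1, ?_⟩
      ext x
      constructor
      · rintro hx w hw hwx p ⟨-, Z, hZ, hpZ⟩
        exact hpZ x (hx Z hZ) w hw hwx
      · intro hx Z hZ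
        obtain ⟨S, hS, rfl⟩ := hA hZ
        intro w hw hwx p hp
        exact hx w hw hwx p ⟨hS p hp, _, hZ, fun y hy w' hw' h' => hy w' hw' h' p hp⟩)
    (by
      rintro _ ⟨S, hS, rfl⟩ _ ⟨T, hT, rfl⟩
      refine ⟨{r | ∃ p ∈ S, ∃ q ∈ T, r = p * q}, ?_, ?_⟩
      · rintro r ⟨p, hp, q, hq, rfl⟩
        obtain ⟨d, hd⟩ := hS p hp
        obtain ⟨e, he⟩ := hT q hq
        exact ⟨d + e, hd.mul he⟩
      · ext x
        constructor
        · rintro (hx | hx) w hw hwx r ⟨p, hp, q, hq, rfl⟩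
          · have := hx w hw hwx p hp
            simp only [polyEval, map_mul] at this ⊢
            rw [this, zero_mul]
          · have := hx w hw hwx q hq
            simp only [polyEval, map_mul] at this ⊢
            rw [this, mul_zero]
        · intro hx
          by_contra hcon
          simp only [Set.mem_union, not_or, projZeroLocus, Set.mem_ofPred_eq, not_forall] at hcon
          obtain ⟨⟨w, hw, hwx, p, hp, hpw⟩, ⟨w', hw', hwx', q, hq, hqw⟩⟩ := hcon
          obtain ⟨c, hc⟩ := (Projectivization.mk_eq_mk_iff' k w' w hw' hw).mp (hwx'.trans hwx.symm)
          obtain ⟨e, he⟩ := hT q hq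
          have h := hx w hw hwx (p * q) ⟨p, hp, q, hq, rfl⟩
          have hqw2 : polyEval q w ≠ 0 := by
            intro h0
            apply hqw
            rw [← hc, polyEval_smul he, h0, mul_zero]
          simp only [polyEval, map_mul] at h
          exact (mul_ne_zero hpw hqw2) h)

end ZariskiTopology

/-! Write `L a` for multiplication by `a`, τ(a) = tr(`L a`) and β(a, b) = τ(ab). Every automorphism
of the algebra preserves τ and β. If β is nondegenerate, it therefore fixes the vector u
representing a nonzero multiple of τ through β, hence also every `(L u)^j u`; if these span V, the
automorphism is trivial (`automorphism_eq_one`). If g fixes the line of m, then g(xy) = c(gx)(gy)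
for some unit c, so cg is an automorphism. It is thus the identity, and g is scalar. Both conditions
say that one polynomial, `rigidityDet`, is nonzero. An explicit algebra shows that it is not
identically zero (`rigidityDet_rigidConst_ne_zero`), and over an infinite field its nonvanishing
gives a dense open set of lines. -/

/-! ### The rigidity polynomial in the structure constants. -/

section StructureConstants

open Matrix

variable {n : ℕ} {A A' : Type*} [CommRing A] [CommRing A']

/-- The matrix of the multiplication by `x` in the algebra with structure constants `c`, that is,
with `e i * e j = ∑ l, c i j l • e l`. -/
def mulMatrix (c : Fin n → Fin n → Fin n → A) (x : Fin n → A) : Matrix (Fin n) (Fin n) A :=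
  of fun l j => ∑ i, x i * c i j l

/-- The traces of the multiplications by the basis vectors. -/
def traceVec (c : Fin n → Fin n → Fin n → A) (i : Fin n) : A :=
  ∑ j, c i j j

/-- The Gram matrix of the bilinear form `(a, b) ↦ tr (L (a * b))`. -/
def traceGram (c : Fin n → Fin n → Fin n → A) : Matrix (Fin n) (Fin n) A :=
  of fun i j => ∑ l, c i j l * traceVec c l

/-- A multiple of the vector that represents the trace form `a ↦ tr (L a)` with respect to the
bilinear form `(a, b) ↦ tr (L (a * b))`. -/
def traceDual (c : Fin n → Fin n → Fin n → A) : Fin n → A :=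
  (traceGram c).adjugate *ᵥ traceVec c

/-- The matrix with columns `u`, `L u u`, `(L u)² u`, …, where `u = traceDual c`. -/
def krylovMatrix (c : Fin n → Fin n → Fin n → A) : Matrix (Fin n) (Fin n) A :=
  of fun i j => (mulMatrix c (traceDual c) ^ (j : ℕ) *ᵥ traceDual c) i

/-- A polynomial in the structure constants whose nonvanishing forces every automorphism to be
trivial. -/
def rigidityDet (c : Fin n → Fin n → Fin n → A) : A :=
  (traceGram c).det * (krylovMatrix c).det

/-- Only ring operations enter, since the adjugate replaces the inverse Gram matrix. Specializing
generic structure constants therefore gives the value at a given algebra. -/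
theorem map_rigidityDet (f : A →+* A') (c : Fin n → Fin n → Fin n → A) :
    f (rigidityDet c) = rigidityDet fun i j l => f (c i j l) := by
  have h1 : ∀ i, f (traceVec c i) = traceVec (fun i j l => f (c i j l)) i := by
    intro i
    simp [traceVec]
  have h2 : f.mapMatrix (traceGram c) = traceGram fun i j l => f (c i j l) := by
    ext i j
    simp [traceGram, h1]
  have h3 : f ∘ traceDual c = traceDual fun i j l => f (c i j l) := by
    ext i
    rw [Function.comp_apply, traceDual, RingHom.map_mulVec, traceDual, ← h2, ← RingHom.map_adjugate]
    congr 1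
    exact funext h1
  have h4 : f.mapMatrix (mulMatrix c (traceDual c)) =
      mulMatrix (fun i j l => f (c i j l)) (traceDual fun i j l => f (c i j l)) := by
    ext i j
    simp [mulMatrix, ← h3]
  have h5 : f.mapMatrix (krylovMatrix c) = krylovMatrix fun i j l => f (c i j l) := by
    ext i j
    rw [RingHom.mapMatrix_apply, map_apply, krylovMatrix, of_apply, RingHom.map_mulVec, krylovMatrix,
      of_apply, ← h4, ← h3, ← map_pow]
    rfl
  rw [rigidityDet, map_mul, RingHom.map_det, RingHom.map_det, h2, h5, rigidityDet]

/-! ### An explicit algebra with nonzero rigidity polynomial. -/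

/-- The structure constants of a commutative algebra in which `e₀` generates everything by repeated
multiplication by itself: `e₀ eⱼ = eⱼ₊₁` (and `e₀ eₙ = eₙ`), and `eᵢ eⱼ = e₀ + δᵢⱼ eᵢ`
for positive `i` and `j`. -/
def rigidConst (k : Type*) [CommRing k] (n : ℕ) (i j l : Fin (n + 1)) : k :=
  if i = 0 then (if (l : ℕ) = min ((j : ℕ) + 1) n then 1 else 0)
  else if j = 0 then (if (l : ℕ) = min ((i : ℕ) + 1) n then 1 else 0)
  else (if l = 0 then 1 else 0) + if i = j ∧ l = i then 1 else 0

theorem rigidConst_comm (k : Type*) [CommRing k] (n : ℕ) (i j l : Fin (n + 1)) :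
    rigidConst k n i j l = rigidConst k n j i l := by
  unfold rigidConst
  by_cases hi : i = 0 <;> by_cases hj : j = 0
  · simp [hi, hj]
  · simp [hi, hj]
  · simp [hi, hj]
  · simp only [hi, hj, if_false]
    congr 2
    apply propext
    constructor <;> rintro ⟨rfl, rfl⟩ <;> simp

theorem sum_ite_val_eq {k : Type*} [CommRing k] {n m : ℕ} (h : m < n) (f : Fin n → k) :
    ∑ l : Fin n, (if (l : ℕ) = m then f l else 0) = f ⟨m, h⟩ := by
  rw [Finset.sum_eq_single ⟨m, h⟩]
  · simp
  · intro b _ hb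
    rw [if_neg]
    intro hbm
    exact hb (Fin.ext hbm)
  · simp

/-- A single diagonal entry survives: `e₀ eₙ = eₙ` for `i = 0`, and the extra summand of `eᵢ eᵢ`
otherwise. -/
theorem traceVec_rigidConst (k : Type*) [CommRing k] (n : ℕ) (i : Fin (n + 1)) :
    traceVec (rigidConst k n) i = 1 := by
  unfold traceVec
  by_cases hi : i = 0
  · subst hi
    rw [Finset.sum_eq_single (Fin.last n)]
    · simp [rigidConst]
    · intro b _ hb
      have : (b : ℕ) < n := by
        have := Fin.val_lt_last hb
        simpa using this
      simp only [rigidConst, if_true]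
      rw [if_neg]
      omega
    · simp
  · have hi' : 0 < (i : ℕ) := Fin.pos_iff_ne_zero.mpr hi
    rw [Finset.sum_eq_single i]
    · simp [rigidConst, hi]
    · intro b _ hb
      by_cases hb0 : b = 0
      · subst hb0
        simp only [rigidConst, hi, if_true, if_false]
        rw [if_neg]
        have := i.2
        simp
        omega
      · simp [rigidConst, hi, hb0, hb.symm]
    · simp

theorem traceGram_rigidConst (k : Type*) [CommRing k] (n : ℕ) (i j : Fin (n + 1)) :
    traceGram (rigidConst k n) i j = 1 + if i ≠ 0 ∧ i = j then 1 else 0 := by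
  simp only [traceGram, of_apply, traceVec_rigidConst, mul_one]
  by_cases hi : i = 0
  · simp only [rigidConst, hi, if_true]
    rw [sum_ite_val_eq (by omega)]
    simp
  · by_cases hj : j = 0
    · simp only [rigidConst, hi, hj, if_true, if_false]
      rw [sum_ite_val_eq (by omega)]
      simp
    · simp only [rigidConst, hi, hj, if_false, Finset.sum_add_distrib]
      by_cases hij : i = j <;> simp [hij, hj]

/-- For a kernel vector, row 0 makes the sum of the coordinates vanish; each other row then kills
its own coordinate. This works in every characteristic. -/
theorem det_traceGram_rigidConst_ne_zero (k : Type*) [Field k] (n : ℕ) :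
    (traceGram (rigidConst k n)).det ≠ 0 := by
  intro h
  obtain ⟨v, hv, h0⟩ := exists_mulVec_eq_zero_iff.mpr h
  have key : ∀ i, ∑ j, v j + (if i ≠ 0 then v i else 0) = 0 := by
    intro i
    have := congrFun h0 i
    simp only [mulVec, dotProduct, traceGram_rigidConst, add_mul, one_mul,
      Finset.sum_add_distrib, Pi.zero_apply] at this
    refine Eq.trans ?_ this
    congr 1
    by_cases hi : i = 0 <;> simp [hi]
  have hs : ∑ j, v j = 0 := by simpa using key 0
  have hi : ∀ i, i ≠ 0 → v i = 0 := by
    intro i hi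
    simpa [hs, hi] using key i
  apply hv
  ext i
  by_cases h' : i = 0
  · subst h'
    rwa [Finset.sum_eq_single 0 (fun b _ hb => hi b hb) (by simp)] at hs
  · exact hi i h'

theorem rigidityDet_rigidConst_ne_zero (k : Type*) [Field k] (n : ℕ) :
    rigidityDet (rigidConst k n) ≠ 0 := by
  have hd := det_traceGram_rigidConst_ne_zero k n
  refine mul_ne_zero hd ?_
  set d := (traceGram (rigidConst k n)).det with hdd
  have hu : traceDual (rigidConst k n) = d • Pi.single 0 1 := by
    -- The all-ones trace vector is column 0 of the Gram matrix, so the adjugate sends it to `d •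
    -- e₀`.
    have : traceVec (rigidConst k n) = traceGram (rigidConst k n) *ᵥ Pi.single 0 1 := by
      ext i
      rw [mulVec_single_one, col_apply, traceGram_rigidConst, traceVec_rigidConst, if_neg, add_zero]
      rintro ⟨h1, h2⟩
      exact h1 h2
    rw [traceDual, this, mulVec_mulVec, adjugate_mul, smul_mulVec, one_mulVec]
  have hL : ∀ (j : ℕ) (hj : j < n + 1), mulMatrix (rigidConst k n) (traceDual (rigidConst k n)) ^ j *ᵥ
      traceDual (rigidConst k n) = d ^ (j + 1) • Pi.single ⟨j, hj⟩ 1 := by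
    intro j
    induction j with
    | zero => intro hj; simpa using hu
    | succ j ih =>
      intro hj
      rw [pow_succ', ← mulVec_mulVec, ih (by omega), mulVec_smul, mulVec_single_one]
      ext l
      simp only [Pi.smul_apply, col_apply, mulMatrix, of_apply, hu, smul_eq_mul]
      rw [Finset.sum_eq_single 0 (by intro b _ hb; simp [hb]) (by simp)]
      have : min (j + 1) n = j + 1 := by omega
      simp only [Pi.single_apply, rigidConst, if_true, this, Fin.ext_iff]
      ring
  have hK : krylovMatrix (rigidConst k n) = diagonal fun j : Fin (n + 1) => d ^ ((j : ℕ) + 1) := by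
    ext i j
    rw [krylovMatrix, of_apply, hL j j.2]
    by_cases hij : i = j <;> simp [hij]
  rw [hK, det_diagonal]
  exact Finset.prod_ne_zero_iff.mpr fun j _ => pow_ne_zero _ hd

end StructureConstants

/-! ### The center of the general linear group. -/

section CenterGL

variable {k V : Type*} [Field k] [AddCommGroup V] [Module k V]

/-- If v and gv were independent, the transvection x ↦ x + φ(x)v with φ(v) = 0 and φ(gv) = 1 would
fix v but move gv, so it would not commute with g. -/
theorem exists_smul_of_mem_center_generalLinearGroup {g : LinearMap.GeneralLinearGroup k V}
    (hg : g ∈ Subgroup.center (LinearMap.GeneralLinearGroup k V)) :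
    ∃ c : k, (g : V →ₗ[k] V) = c • 1 := by
  refine LinearMap.exists_eq_smul_id_of_forall_notLinearIndependent fun v hv => ?_
  obtain ⟨φ, h0, h1⟩ : ∃ φ : Module.Dual k V, φ v = 0 ∧ φ ((g : V →ₗ[k] V) v) = 1 := by
    have hmem : (g : V →ₗ[k] V) v ∉ Submodule.span k {v} := by
      intro hmem
      obtain ⟨a, ha⟩ := Submodule.mem_span_singleton.mp hmem
      exact ((LinearIndependent.pair_iff' (hv.ne_zero 0)).mp hv) a ha
    obtain ⟨φ, hφ, hφ0⟩ := Submodule.exists_le_ker_of_notMem hmem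
    refine ⟨(φ ((g : V →ₗ[k] V) v))⁻¹ • φ, ?_, ?_⟩
    · simp [LinearMap.mem_ker.mp (hφ0 (Submodule.mem_span_singleton_self v))]
    · simp [hφ]
  have hcomm := Subgroup.mem_center_iff.mp hg
    (LinearMap.GeneralLinearGroup.ofLinearEquiv (LinearEquiv.transvection h0))
  have := LinearMap.congr_fun (congrArg Units.val hcomm) v
  simp [LinearMap.transvection.apply, h0, h1] at this
  exact hv.ne_zero 0 this

theorem mem_center_generalLinearGroup_of_eq_smul {g : LinearMap.GeneralLinearGroup k V} {c : k}
    (hg : (g : V →ₗ[k] V) = c • 1) :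
    g ∈ Subgroup.center (LinearMap.GeneralLinearGroup k V) := by
  refine Subgroup.mem_center_iff.mpr fun h => Units.ext ?_
  rw [Units.val_mul, Units.val_mul, hg]
  simp

end CenterGL

/-! ### Dense open sets in projective space. -/

section ProjectiveZariski

variable {k W : Type*} [Field k] [AddCommGroup W] [Module k W]

open Polynomial in
/-- The restriction of a polynomial function to a line. -/
theorem exists_polynomial_eval_eq_polyEval_line (p : MvPolynomial (Module.Dual k W) k) (v w : W) :
    ∃ f : k[X], ∀ t : k, f.eval t = polyEval p (v + t • w) := by
  refine ⟨MvPolynomial.eval₂ C (fun l => C (l v) + X * C (l w)) p, fun t => ?_⟩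
  rw [← coe_evalRingHom, MvPolynomial.hom_eval₂, polyEval, MvPolynomial.eval, MvPolynomial.coe_eval₂Hom]
  congr 1
  · ext a
    simp
  · ext l
    simpa using mul_comm _ _

theorem exists_ne_zero_polyEval_ne_zero [Infinite k] {p q : MvPolynomial (Module.Dual k W) k}
    {v w : W} (hv : v ≠ 0) (hp : polyEval p v ≠ 0) (hq : polyEval q w ≠ 0) :
    ∃ z : W, z ≠ 0 ∧ polyEval p z ≠ 0 ∧ polyEval q z ≠ 0 := by
  obtain ⟨f, hf⟩ := exists_polynomial_eval_eq_polyEval_line p v (w - v)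
  obtain ⟨g, hg⟩ := exists_polynomial_eval_eq_polyEval_line q v (w - v)
  obtain ⟨l, hl⟩ : ∃ l : Module.Dual k W, l v ≠ 0 := by
    by_contra! h
    exact hv ((Module.forall_dual_apply_eq_zero_iff k v).mp h)
  -- The third factor, a linear form nonzero at `v`, keeps the chosen point of the line away from
  -- the origin.
  obtain ⟨e, he⟩ := exists_polynomial_eval_eq_polyEval_line (MvPolynomial.X l) v (w - v)
  have hf0 : f ≠ 0 := by
    rintro rfl
    exact hp (by simpa using (hf 0).symm)
  have hg0 : g ≠ 0 := by
    rintro rfl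
    exact hq (by simpa using (hg 1).symm)
  have he0 : e ≠ 0 := by
    rintro rfl
    exact hl (by simpa [polyEval] using (he 0).symm)
  obtain ⟨t, ht⟩ : ∃ t, (e * f * g).eval t ≠ 0 := by
    by_contra! h
    exact mul_ne_zero (mul_ne_zero he0 hf0) hg0 (Polynomial.funext fun t => by simpa using h t)
  rw [Polynomial.eval_mul, Polynomial.eval_mul, he, hf, hg] at ht
  refine ⟨v + t • (w - v), fun h0 => ?_, right_ne_zero_of_mul (left_ne_zero_of_mul ht),
    right_ne_zero_of_mul ht⟩
  rw [h0] at ht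
  simp [polyEval] at ht

/-- The points of a projective space at which some homogeneous component of `p` does not vanish. -/
def homogeneousNonvanishingLocus (p : MvPolynomial (Module.Dual k W) k) : Set (ℙ k W) :=
  (projZeroLocus (Set.range fun d => p.homogeneousComponent d))ᶜ

theorem isOpen_compl_projZeroLocus {S : Set (MvPolynomial (Module.Dual k W) k)}
    (hS : ∀ p ∈ S, ∃ d : ℕ, p.IsHomogeneous d) : IsOpen (projZeroLocus S)ᶜ := by
  change (projZeroLocus S)ᶜᶜ ∈ {Z | ∃ S : Set (MvPolynomial (Module.Dual k W) k),
      (∀ p ∈ S, ∃ d : ℕ, p.IsHomogeneous d) ∧ Z = projZeroLocus S}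
  exact ⟨S, hS, compl_compl _⟩

theorem exists_eq_compl_projZeroLocus_of_isOpen {O : Set (ℙ k W)} (hO : IsOpen O) :
    ∃ S : Set (MvPolynomial (Module.Dual k W) k),
      (∀ p ∈ S, ∃ d : ℕ, p.IsHomogeneous d) ∧ O = (projZeroLocus S)ᶜ := by
  obtain ⟨S, hS, h⟩ : Oᶜ ∈ {Z | ∃ S : Set (MvPolynomial (Module.Dual k W) k),
      (∀ p ∈ S, ∃ d : ℕ, p.IsHomogeneous d) ∧ Z = projZeroLocus S} := hO
  exact ⟨S, hS, by rw [← h, compl_compl]⟩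

theorem isOpen_homogeneousNonvanishingLocus (p : MvPolynomial (Module.Dual k W) k) :
    IsOpen (homogeneousNonvanishingLocus p) := by
  apply isOpen_compl_projZeroLocus
  rintro _ ⟨d, rfl⟩
  exact ⟨d, MvPolynomial.homogeneousComponent_isHomogeneous d p⟩

theorem polyEval_smul_eq_sum (p : MvPolynomial (Module.Dual k W) k) (c : k) (w : W) :
    polyEval p (c • w) = ∑ d ∈ Finset.range (p.totalDegree + 1),
      c ^ d * polyEval (p.homogeneousComponent d) w := by
  conv_lhs => rw [← MvPolynomial.sum_homogeneousComponent p]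
  rw [polyEval, map_sum]
  refine Finset.sum_congr rfl fun d _ => ?_
  exact polyEval_smul (MvPolynomial.homogeneousComponent_isHomogeneous d p) c w

theorem mk_mem_homogeneousNonvanishingLocus {p : MvPolynomial (Module.Dual k W) k} {w : W}
    (hw : w ≠ 0) (h : polyEval p w ≠ 0) :
    Projectivization.mk k w hw ∈ homogeneousNonvanishingLocus p := by
  intro hx
  apply h
  rw [← one_smul k w, polyEval_smul_eq_sum]
  refine Finset.sum_eq_zero fun d _ => ?_
  rw [hx w hw rfl _ ⟨d, rfl⟩, mul_zero]

open Polynomial in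
-- Along the line, p(tw) is a polynomial in t whose coefficients are the values of the homogeneous
-- components at w, so it is nonzero at some t ≠ 0. This spares a proof that `rigidityPoly` is
-- homogeneous.
theorem exists_rep_of_mem_homogeneousNonvanishingLocus [Infinite k]
    {p : MvPolynomial (Module.Dual k W) k} {x : ℙ k W} (hx : x ∈ homogeneousNonvanishingLocus p) :
    ∃ (w : W) (hw : w ≠ 0), Projectivization.mk k w hw = x ∧ polyEval p w ≠ 0 := by
  simp only [homogeneousNonvanishingLocus, projZeroLocus, Set.mem_compl_iff, Set.mem_ofPred_eq,
    not_forall] at hx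
  obtain ⟨w, hw, hwx, _, ⟨d, rfl⟩, hd⟩ := hx
  set f : k[X] := ∑ e ∈ Finset.range (p.totalDegree + 1),
    C (polyEval (p.homogeneousComponent e) w) * X ^ e with hf
  have hf0 : f ≠ 0 := by
    intro h0
    apply hd
    have hdt : d ∈ Finset.range (p.totalDegree + 1) := by
      by_contra hdt
      apply hd
      dsimp only
      rw [MvPolynomial.homogeneousComponent_eq_zero _ _ (by simpa using hdt), polyEval, map_zero]
    have := congrArg (fun f => f.coeff d) h0
    simpa [hf, finsetSum_coeff, coeff_X_pow, hdt] using this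
  obtain ⟨t, ht⟩ : ∃ t, (X * f).eval t ≠ 0 := by
    by_contra! h
    exact mul_ne_zero X_ne_zero hf0 (Polynomial.funext fun t => by simpa using h t)
  rw [eval_mul, eval_X] at ht
  have ht0 := left_ne_zero_of_mul ht
  refine ⟨t • w, smul_ne_zero ht0 hw, ?_, ?_⟩
  · rw [← hwx, Projectivization.mk_eq_mk_iff']
    exact ⟨t, rfl⟩
  · rw [polyEval_smul_eq_sum]
    convert right_ne_zero_of_mul ht using 1
    rw [hf, eval_finsetSum]
    exact Finset.sum_congr rfl fun e _ => by rw [eval_C_mul, eval_pow, eval_X, mul_comm]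

theorem dense_homogeneousNonvanishingLocus [Infinite k] {p : MvPolynomial (Module.Dual k W) k}
    {w : W} (hw : polyEval p w ≠ 0) : Dense (homogeneousNonvanishingLocus p) := by
  rw [dense_iff_inter_open]
  rintro O hO ⟨x, hx⟩
  obtain ⟨S, hS, rfl⟩ := exists_eq_compl_projZeroLocus_of_isOpen hO
  simp only [projZeroLocus, Set.mem_compl_iff, Set.mem_ofPred_eq, not_forall] at hx
  obtain ⟨v, hv, -, q, hq, hqv⟩ := hx
  obtain ⟨z, hz, hqz, hpz⟩ := exists_ne_zero_polyEval_ne_zero hv hqv hw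
  exact ⟨Projectivization.mk k z hz, fun h => hqz (h z hz rfl q hq),
    mk_mem_homogeneousNonvanishingLocus hz hpz⟩

end ProjectiveZariski

/-! ### Triviality of the automorphism group. -/

section Automorphisms

open Matrix Module

variable {k V : Type*} [Field k] [AddCommGroup V] [Module k V] {n : ℕ}

/-- The structure constants of a multiplication on `V` in a basis. -/
noncomputable def structureConst (b : Basis (Fin n) k V) (m : V →ₗ[k] V →ₗ[k] V)
    (i j l : Fin n) : k :=
  b.repr (m (b i) (b j)) l

theorem toMatrix_eq_mulMatrix (b : Basis (Fin n) k V) (m : V →ₗ[k] V →ₗ[k] V) (a : V) :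
    LinearMap.toMatrix b b (m a) = mulMatrix (structureConst b m) (b.repr a) := by
  ext l j
  rw [LinearMap.toMatrix_apply, mulMatrix, of_apply]
  conv_lhs => rw [← b.sum_repr a]
  simp only [map_sum, map_smul, LinearMap.sum_apply, LinearMap.smul_apply, Finsupp.finsetSum_apply,
    Finsupp.smul_apply, smul_eq_mul, structureConst]

theorem trace_eq_dotProduct_traceVec (b : Basis (Fin n) k V) (m : V →ₗ[k] V →ₗ[k] V) (a : V) :
    LinearMap.trace k V (m a) = b.repr a ⬝ᵥ traceVec (structureConst b m) := by
  rw [LinearMap.trace_eq_matrix_trace k b, toMatrix_eq_mulMatrix, Matrix.trace]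
  simp only [diag_apply, mulMatrix, of_apply, dotProduct, traceVec, Finset.mul_sum]
  exact Finset.sum_comm

theorem trace_mul_eq_traceGram_mulVec (b : Basis (Fin n) k V) (m : V →ₗ[k] V →ₗ[k] V) (i : Fin n)
    (a : V) :
    LinearMap.trace k V (m (m (b i) a)) = (traceGram (structureConst b m) *ᵥ b.repr a) i := by
  rw [trace_eq_dotProduct_traceVec b]
  conv_lhs => rw [← b.sum_repr a]
  simp only [map_sum, map_smul, dotProduct, mulVec, traceGram, of_apply, Finsupp.finsetSum_apply,
    Finsupp.smul_apply, smul_eq_mul, Finset.sum_mul]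
  rw [Finset.sum_comm]
  refine Finset.sum_congr rfl fun j _ => Finset.sum_congr rfl fun l _ => ?_
  rw [structureConst]
  ring

theorem trace_mul_map_automorphism {m : V →ₗ[k] V →ₗ[k] V} {h : V ≃ₗ[k] V}
    (hm : ∀ a b, h (m a b) = m (h a) (h b)) (a : V) :
    LinearMap.trace k V (m (h a)) = LinearMap.trace k V (m a) := by
  rw [← LinearMap.trace_conj' (m a) h]
  congr 1
  ext x
  simp [LinearEquiv.conj_apply, hm]

/-- An algebra for which `rigidityDet` does not vanish has only the trivial automorphism. -/
theorem automorphism_eq_one {b : Basis (Fin n) k V} {m : V →ₗ[k] V →ₗ[k] V}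
    (hdet : rigidityDet (structureConst b m) ≠ 0) {h : V ≃ₗ[k] V}
    (hm : ∀ a b, h (m a b) = m (h a) (h b)) : h = LinearEquiv.refl k V := by
  set c := structureConst b m with hc
  have hG : (traceGram c).det ≠ 0 := left_ne_zero_of_mul hdet
  have hK : (krylovMatrix c).det ≠ 0 := right_ne_zero_of_mul hdet
  set u : V := b.equivFun.symm (traceDual c) with hu
  have hru : ⇑(b.repr u) = traceDual c := by
    rw [← b.equivFun_apply, hu, LinearEquiv.apply_symm_apply]
  have hform : ∀ a, LinearMap.trace k V (m (m a u)) =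
      (traceGram c).det * LinearMap.trace k V (m a) := by
    have : LinearMap.trace k V ∘ₗ m ∘ₗ m.flip u =
        (traceGram c).det • (LinearMap.trace k V ∘ₗ m) := by
      refine b.ext fun i => ?_
      simp only [LinearMap.comp_apply, LinearMap.flip_apply, LinearMap.smul_apply]
      rw [trace_mul_eq_traceGram_mulVec, ← hc, hru, traceDual, mulVec_mulVec, mul_adjugate,
        smul_mulVec, one_mulVec, trace_eq_dotProduct_traceVec b, ← hc, b.repr_self,
        Finsupp.single_eq_pi_single, single_one_dotProduct, Pi.smul_apply]
    exact fun a => LinearMap.congr_fun this a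
  have hfix : h u = u := by
    rw [← sub_eq_zero]
    by_contra hne
    apply hG
    refine exists_mulVec_eq_zero_iff.mp ⟨b.repr (h u - u), ?_, ?_⟩
    · intro h0
      exact hne (b.repr.map_eq_zero_iff.mp (DFunLike.coe_injective h0))
    · ext i
      rw [hc, ← trace_mul_eq_traceGram_mulVec, map_sub, map_sub, map_sub, hform, Pi.zero_apply]
      -- With D the Gram determinant, β(ha, hu) = β(a, u) = Dτ(a) = Dτ(ha) = β(ha, u), so hu − u
      -- lies in the kernel of the Gram matrix.
      obtain ⟨a, ha⟩ := h.surjective (b i)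
      rw [← ha, ← hm, trace_mul_map_automorphism hm, hform, trace_mul_map_automorphism hm, sub_self]
  have hpow : ∀ j : ℕ, h ((m u ^ j) u) = (m u ^ j) u := by
    intro j
    induction j with
    | zero => simpa using hfix
    | succ j ih => rw [pow_succ', Module.End.mul_apply, hm, hfix, ih]
  have hHK : LinearMap.toMatrix b b (h : V →ₗ[k] V) * krylovMatrix c = krylovMatrix c := by
    have hcol : ∀ j : Fin n, (krylovMatrix c).col j = b.repr ((m u ^ (j : ℕ)) u) := by
      intro j
      rw [← LinearMap.toMatrix_mulVec_repr b b, ← LinearMap.toMatrix_pow, toMatrix_eq_mulMatrix, ← hc,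
        hru]
      rfl
    ext i j
    change (LinearMap.toMatrix b b (h : V →ₗ[k] V) *ᵥ (krylovMatrix c).col j) i =
      (krylovMatrix c).col j i
    rw [hcol, LinearMap.toMatrix_mulVec_repr, LinearEquiv.coe_coe, hpow]
  have hone : LinearMap.toMatrix b b (h : V →ₗ[k] V) = 1 := by
    have hunit : IsUnit (krylovMatrix c) :=
      (isUnit_iff_isUnit_det _).mpr (isUnit_iff_ne_zero.mpr hK)
    exact hunit.mul_right_cancel (by rw [hHK, one_mul])
  rw [← LinearMap.toMatrix_id b] at hone
  exact LinearEquiv.toLinearMap_injective ((LinearMap.toMatrix b b).injective hone)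

end Automorphisms

/-! ### Stabilizers of generic lines. -/

section GenericStabilizer

open Module

variable {k V : Type*} [Field k] [AddCommGroup V] [Module k V] {n : ℕ}

/-- The structure constants as linear forms on the space of commutative multiplications. -/
noncomputable def structureConstForm (b : Basis (Fin n) k V) (i j l : Fin n) :
    Dual k (CommMul k V) :=
  b.coord l ∘ₗ LinearMap.applyₗ (b j) ∘ₗ LinearMap.applyₗ (b i) ∘ₗ (CommMul k V).subtype

/-- `rigidityDet` as a polynomial in linear forms on the space of commutative multiplications. -/
noncomputable def rigidityPoly (b : Basis (Fin n) k V) : MvPolynomial (Dual k (CommMul k V)) k :=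
  rigidityDet fun i j l => MvPolynomial.X (structureConstForm b i j l)

theorem polyEval_rigidityPoly (b : Basis (Fin n) k V) (m : CommMul k V) :
    polyEval (rigidityPoly b) m = rigidityDet (structureConst b m) := by
  rw [polyEval, rigidityPoly, map_rigidityDet]
  congr 1
  ext i j l
  rw [MvPolynomial.eval_X]
  rfl

theorem exists_polyEval_rigidityPoly_ne_zero (b : Basis (Fin n) k V) :
    ∃ m : CommMul k V, polyEval (rigidityPoly b) m ≠ 0 := by
  simp only [polyEval_rigidityPoly]
  cases n with
  | zero => exact ⟨0, by simp [rigidityDet]⟩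
  | succ n =>
    set m : V →ₗ[k] V →ₗ[k] V :=
      b.constr k fun i => b.constr k fun j => ∑ l, rigidConst k n i j l • b l with hm
    have hb : ∀ i j, m (b i) (b j) = ∑ l, rigidConst k n i j l • b l := by
      intro i j
      rw [hm, b.constr_basis, b.constr_basis]
    have hflip : m = m.flip := by
      refine b.ext fun i => b.ext fun j => ?_
      rw [LinearMap.flip_apply, hb, hb]
      simp only [rigidConst_comm k n i j]
    have hc : structureConst b m = rigidConst k n := by
      ext i j l
      rw [structureConst, hb, b.repr_sum_self]
    refine ⟨⟨m, fun x y => LinearMap.congr_fun₂ hflip x y⟩, ?_⟩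
    rw [hc]
    exact rigidityDet_rigidConst_ne_zero k n

theorem smul_mk_eq_of_eq_smul {g : LinearMap.GeneralLinearGroup k V} {c : k}
    (hg : (g : V →ₗ[k] V) = c • 1) (x : ℙ k (CommMul k V)) : g • x = x := by
  induction x using Projectivization.ind with
  | _ m hm =>
    rw [Projectivization.smul_mk, Projectivization.mk_eq_mk_iff']
    have hinv : ∀ a, c • (↑g⁻¹ : V →ₗ[k] V) a = a := by
      intro a
      have := LinearMap.congr_fun (congrArg Units.val (mul_inv_cancel g)) a
      rw [Units.val_mul, hg] at this
      simpa using this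
    -- `c = 0` is possible only if `V` is zero. Otherwise `g` acts on multiplications as `c · c⁻² =
    -- c⁻¹`.
    rcases eq_or_ne c 0 with rfl | hc
    · refine ⟨1, CommMul.ext_apply fun a b => ?_⟩
      rw [← hinv a]
      simp
    · refine ⟨c⁻¹, CommMul.ext_apply fun a b => ?_⟩
      have hinv' : ∀ a, (↑g⁻¹ : V →ₗ[k] V) a = c⁻¹ • a := fun a => by
        rw [eq_inv_smul_iff₀ hc, hinv]
      rw [CommMul.smul_apply, hinv', hinv', hg]
      simp [hc]

theorem exists_eq_smul_of_smul_mk_eq {b : Basis (Fin n) k V} {m : CommMul k V} (hm : m ≠ 0)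
    (hdet : rigidityDet (structureConst b m) ≠ 0) {g : LinearMap.GeneralLinearGroup k V}
    (hg : g • Projectivization.mk k m hm = Projectivization.mk k m hm) :
    ∃ c : k, (g : V →ₗ[k] V) = c • 1 := by
  rw [Projectivization.smul_mk, Projectivization.mk_eq_mk_iff] at hg
  obtain ⟨c, hc⟩ := hg
  have hinv : ∀ a, (↑g⁻¹ : V →ₗ[k] V) ((g : V →ₗ[k] V) a) = a := by
    intro a
    rw [← Module.End.mul_apply, ← Units.val_mul, inv_mul_cancel]
    rfl
  have hmul : ∀ x y, (g : V →ₗ[k] V) ((m : V →ₗ[k] V →ₗ[k] V) x y) =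
      c • (m : V →ₗ[k] V →ₗ[k] V) ((g : V →ₗ[k] V) x) ((g : V →ₗ[k] V) y) := by
    intro x y
    have := congrArg (fun m' : CommMul k V =>
      (m' : V →ₗ[k] V →ₗ[k] V) ((g : V →ₗ[k] V) x) ((g : V →ₗ[k] V) y)) hc
    simp only [CommMul.smul_apply, hinv] at this
    rw [← this]
    rfl
  -- Rescaling by `c` absorbs the factor in `hmul`: both c·g(xy) and (cgx)(cgy) equal c²(gx)(gy).
  set h : V ≃ₗ[k] V := g.toLinearEquiv.trans (LinearEquiv.smulOfUnit c) with hh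
  have happ : ∀ x, h x = c • (g : V →ₗ[k] V) x := fun x => rfl
  have hone : h = LinearEquiv.refl k V := by
    refine automorphism_eq_one hdet fun x y => ?_
    simp only [happ, hmul, Units.smul_def, map_smul, LinearMap.smul_apply]
  refine ⟨(↑c⁻¹ : k), LinearMap.ext fun x => ?_⟩
  have hx : c • (g : V →ₗ[k] V) x = x := by rw [← happ, hone, LinearEquiv.refl_apply]
  rw [LinearMap.smul_apply, Module.End.one_apply, ← Units.smul_def, eq_inv_smul_iff, hx]

end GenericStabilizer

theorem mainTheorem12 {k V : Type*} [Field k] [IsAlgClosed k] (hchar : ringChar k ≠ 2)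
    [AddCommGroup V] [Module k V] [FiniteDimensional k V] :
    ∃ U : Set (ℙ k (CommMul k V)), IsOpen U ∧ Dense U ∧
      ∀ x ∈ U, MulAction.stabilizer (LinearMap.GeneralLinearGroup k V) x =
        Subgroup.center (LinearMap.GeneralLinearGroup k V) := by
  have : Infinite k := IsAlgClosed.instInfinite
  let b := Module.finBasis k V
  obtain ⟨m, hm⟩ := exists_polyEval_rigidityPoly_ne_zero b
  refine ⟨homogeneousNonvanishingLocus (rigidityPoly b), isOpen_homogeneousNonvanishingLocus _,
    dense_homogeneousNonvanishingLocus hm, fun x hx => ?_⟩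
  obtain ⟨w, hw, rfl, hpw⟩ := exists_rep_of_mem_homogeneousNonvanishingLocus hx
  rw [polyEval_rigidityPoly] at hpw
  ext g
  rw [MulAction.mem_stabilizer_iff]
  constructor
  · intro hg
    obtain ⟨c, hc⟩ := exists_eq_smul_of_smul_mk_eq hw hpw hg
    exact mem_center_generalLinearGroup_of_eq_smul hc
  · intro hg
    obtain ⟨c, hc⟩ := exists_smul_of_mem_center_generalLinearGroup hg
    exact smul_mk_eq_of_eq_smul hc _
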